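/- For a permutation $\pi$ of $\{1,\dots,n\}$ write $|\pi|=n$. Let $\mathrm{fp}(\pi)$, $\mathrm{exc}(\pi)$ and $\mathrm{dexc}(\pi)$ be the numbers of indices $i$ with $\pi(i)=i$, with $i<\pi(i)$, and with $i<\pi(i)<\pi(\pi(i))$, respectively, and let $\mathrm{cyc}(\pi)$ be the number of cycles of $\pi$, fixed points included. Say that $\pi$ has increasing excedances if $\pi(i)<\pi(j)$ whenever $i<j$, $i<\pi(i)$ and $j<\pi(j)$, and that $\pi$ is cyclic if $\mathrm{cyc}(\pi)=1$. Let $\mathcal{I}$ be the set of permutations (of all lengths $n\ge 0$) with increasing excedances, let $\mathcal{CI}\subset\mathcal{I}$ be the subset of cyclic ones, and let $\mathcal{CI}_n$ be the set of $\pi\in\mathcal{CI}$ with $|\pi|=n$. For sequences $\mathbf d=(d_1,d_2,\dots)$ and $\boldsymbol\ell=(\ell_0,\ell_1,\dots)$ in a commutative ring let $$J_{\mathbf d,\boldsymbol\ell}(z)=\cfrac{1}{1-\ell_0z-\cfrac{d_1z^2}{1-\ell_1z-\cfrac{d_2z^2}{\ddots}}},\qquad K_{\mathbf d,\boldsymbol\ell}(z)=\ell_0z+\cfrac{d_1z^2}{1-\ell_1z-\cfrac{d_2z^2}{1-\ell_2z-\cfrac{d_3z^2}{\ddots}}}$$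 as formal power series in $z$ (the coefficientwise limits of the finite truncations). Then, with $x,v,w,t$ formal variables (equivalently, arbitrary elements of a commutative ring): 1. $$\sum_{\pi\in\mathcal{I}}x^{\mathrm{fp}(\pi)}v^{\mathrm{exc}(\pi)}w^{\mathrm{dexc}(\pi)}t^{\mathrm{cyc}(\pi)}z^{|\pi|}=J_{\mathbf d,\boldsymbol\ell}(z)$$ with $d_h=v(h-1+t)$ for $h\ge1$, $\ell_0=xt$, and $\ell_h=xt+vw+h$ for $h\ge1$. 2. $$\sum_{\pi\in\mathcal{CI}}x^{\mathrm{fp}(\pi)}v^{\mathrm{exc}(\pi)}w^{\mathrm{dexc}(\pi)}z^{|\pi|}=K_{\mathbf d,\boldsymbol\ell}(z)$$ with $d_1=v$, $d_h=(h-1)v$ for $h\ge2$, $\ell_0=x$, and $\ell_h=vw+h$ for $h\ge1$; and, with the number of cycles recorded as well, $$\sum_{\pi\in\mathcal{CI}}x^{\mathrm{fp}(\pi)}v^{\mathrm{exc}(\pi)}w^{\mathrm{dexc}(\pi)}t^{\mathrm{cyc}(\pi)}z^{|\pi|}=t\,K_{\mathbf d,\boldsymbol\ell}(z)$$ with the same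 $\mathbf d$ and $\boldsymbol\ell$. 3. $\sum_{n\ge1}|\mathcal{CI}_n|\,z^n=K_{\mathbf d,\boldsymbol\ell}(z)$ with $d_1=1$, $d_h=h-1$ for $h\ge2$, and $\ell_h=h+1$ for $h\ge0$, that is, $$\sum_{n\ge1}|\mathcal{CI}_n|\,z^n=z+\cfrac{z^2}{1-2z-\cfrac{z^2}{1-3z-\cfrac{2z^2}{1-4z-\cfrac{3z^2}{\ddots}}}}.$$ -/

import Mathlib

open PowerSeries

namespace PermStat

/-- Number of fixed points. -/
def fp {n : ℕ} (π : Equiv.Perm (Fin n)) : ℕ :=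
  (Finset.univ.filter fun i : Fin n => π i = i).card

/-- Number of excedances. An excedance is a value `π i` with `i < π i`; since `π` is injective,
these values are counted by their positions `i`. -/
def exc {n : ℕ} (π : Equiv.Perm (Fin n)) : ℕ :=
  (Finset.univ.filter fun i : Fin n => i < π i).card

/-- Number of double excedances: values `π i` with `i < π i < π (π i)`. -/
def dexc {n : ℕ} (π : Equiv.Perm (Fin n)) : ℕ :=
  (Finset.univ.filter fun i : Fin n => i < π i ∧ π i < π (π i)).card

/-- Number of cycles, fixed points included: the number of classes of the relation
"`i` and `j` lie in the same cycle of `π`". -/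
noncomputable def cyc {n : ℕ} (π : Equiv.Perm (Fin n)) : ℕ :=
  Nat.card (Quotient (Equiv.Perm.SameCycle.setoid π))

/-- The subsequence of the excedances of `π` is increasing. -/
def IncreasingExcedances {n : ℕ} (π : Equiv.Perm (Fin n)) : Prop :=
  ∀ i j : Fin n, i < j → i < π i → j < π j → π i < π j

/-- `π` consists of exactly one cycle (so the permutation of one point is cyclic, and the
permutation of the empty set is not). -/
def IsCyclic {n : ℕ} (π : Equiv.Perm (Fin n)) : Prop :=
  cyc π = 1

open Classical in
/-- The permutations of length `n` with increasing excedances. -/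
noncomputable def IE (n : ℕ) : Finset (Equiv.Perm (Fin n)) :=
  Finset.univ.filter fun π => IncreasingExcedances π

open Classical in
/-- The cyclic permutations of length `n` with increasing excedances. -/
noncomputable def CIE (n : ℕ) : Finset (Equiv.Perm (Fin n)) :=
  Finset.univ.filter fun π => IsCyclic π ∧ IncreasingExcedances π

variable {R : Type*} [CommRing R]

/-- The finite continued fraction
`1 / (1 - ℓ₀ z - d₁ z² / (1 - ℓ₁ z - d₂ z² / ( ⋯ / (1 - ℓ_{N-1} z))))` with `N` denominators,
as a formal power series in `z = X`. Every denominator has constant term `1`, so that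
`invOfUnit _ 1` is its true inverse. -/
noncomputable def jConvergent : ℕ → (ℕ → R) → (ℕ → R) → R⟦X⟧
  | 0, _, _ => 0
  | N + 1, d, l =>
      invOfUnit
        (1 - C (l 0) * X
          - C (d 1) * X ^ 2 * jConvergent N (fun h => d (h + 1)) (fun h => l (h + 1))) 1

/-- The J-fraction `1 / (1 - ℓ₀ z - d₁ z² / (1 - ℓ₁ z - d₂ z² / ⋱))` as a formal power series, the
coefficientwise limit of the finite continued fractions (see `coeff_jConvergent`). The entry
`d 0` is not used. -/
noncomputable def jFraction (d l : ℕ → R) : R⟦X⟧ :=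
  PowerSeries.mk fun n => coeff n (jConvergent (n + 1) d l)

/-- The elevated fraction `ℓ₀ z + d₁ z² / (1 - ℓ₁ z - d₂ z² / (1 - ℓ₂ z - d₃ z² / ⋱))`. -/
noncomputable def kFraction (d l : ℕ → R) : R⟦X⟧ :=
  C (l 0) * X + C (d 1) * X ^ 2 * jFraction (fun h => d (h + 1)) (fun h => l (h + 1))

theorem jConvergent_succ_mul (N : ℕ) (d l : ℕ → R) :
    (1 - C (l 0) * X
      - C (d 1) * X ^ 2 * jConvergent N (fun h => d (h + 1)) (fun h => l (h + 1)))
      * jConvergent (N + 1) d l = 1 := by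
  rw [jConvergent]
  apply mul_invOfUnit
  simp

theorem X_pow_dvd_jConvergent_sub (N : ℕ) (d l : ℕ → R) :
    (X : R⟦X⟧) ^ N ∣ jConvergent (N + 1) d l - jConvergent N d l := by
  induction N generalizing d l with
  | zero => simp
  | succ N ih =>
    obtain ⟨q, hq⟩ := ih (fun h => d (h + 1)) (fun h => l (h + 1))
    have h1 := jConvergent_succ_mul (N + 1) d l
    have h2 := jConvergent_succ_mul N d l
    refine ⟨jConvergent (N + 1 + 1) d l * jConvergent (N + 1) d l * C (d 1) * X * q, ?_⟩
    linear_combination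
      (jConvergent (N + 1) d l) * h1 - (jConvergent (N + 1 + 1) d l) * h2
        + jConvergent (N + 1 + 1) d l * jConvergent (N + 1) d l * C (d 1) * X ^ 2 * hq

/-- The coefficients of the finite continued fractions are eventually constant, with value the
coefficient of the J-fraction. -/
theorem coeff_jConvergent (d l : ℕ → R) (n N : ℕ) (h : n < N) :
    coeff n (jConvergent N d l) = coeff n (jFraction d l) := by
  induction N, h using Nat.le_induction with
  | base => simp [jFraction]
  | succ N hN ih =>
    rw [← ih, ← sub_eq_zero, ← map_sub]
    exact X_pow_dvd_iff.mp (X_pow_dvd_jConvergent_sub N d l) n hN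

end PermStat

namespace PermStat

/-! ### Maps between cycle sets. -/

section Cycles

/-! Permutations are built by adding their largest point repeatedly. To know at once where an
excedance goes, a set of marked positions is carried along: a marked position has an excedance whose
value is one of the points still to be added. With `h` marks present, there are these possibilities
for the new point. It may be marked: placed in a new cycle (`v * t`) or after a marked position (`v`
for each of `h` choices), it raises the number of marks to `h + 1`. It may be unmarked, as a fixed
point (`x * t`) or after a marked position that stays marked (weight 1, `h` choices). Or it becomes
the value of a marked position, which then loses its mark. That position must be the least marked
one, since the others receive larger values later; so there is no choice. The new point is then
either unmarked (weight 1) or itself marked, a double excedance (`v * w`). These are the up, level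
and down steps of weighted Motzkin paths, so `markedSum` obeys the recurrence
(`markedSum_succ_zero`, `markedSum_succ_succ`) solved by the J-fraction
(`mk_eq_jFraction_of_recurrence`). Its column without marks is the first claim. For the cyclic case,
`ℓ₀` and `d₁` are both divisible by `t`, whence `J = 1 + t A J`. The coefficient of `t` in `J` is
`A` at `t = 0`, which is the elevated fraction. -/

theorem sameCycle_map {α β : Type*} {σ : Equiv.Perm α} {τ : Equiv.Perm β} (f : α → β)
    (hf : ∀ a, τ.SameCycle (f a) (f (σ a))) {a b : α} (h : σ.SameCycle a b) :
    τ.SameCycle (f a) (f b) := by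
  obtain ⟨k, rfl⟩ := h
  induction k with
  | zero => simpa using Equiv.Perm.SameCycle.refl _ _
  | succ k ih =>
    rw [zpow_add, zpow_one, (Commute.zpow_self σ k).eq]
    exact ih.trans (hf _)
  | pred k ih =>
    have := hf ((σ ^ (-(k : ℤ) - 1)) a)
    rw [← Equiv.Perm.mul_apply, ← zpow_one_add] at this
    rw [show (1 : ℤ) + (-(k : ℤ) - 1) = -k by ring] at this
    exact ih.trans this.symm

end Cycles

/-! ### Adding a largest point to a permutation. -/

section Insertion

variable {n : ℕ}

/-- Extend a permutation of `Fin n` by the fixed point `Fin.last n`. -/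
def extendLast (σ : Equiv.Perm (Fin n)) : Equiv.Perm (Fin (n + 1)) :=
  finSuccEquivLast.symm.permCongr σ.optionCongr

@[simp] theorem extendLast_last (σ : Equiv.Perm (Fin n)) :
    extendLast σ (Fin.last n) = Fin.last n := by
  simp [extendLast, Equiv.permCongr_apply]

@[simp] theorem extendLast_castSucc (σ : Equiv.Perm (Fin n)) (i : Fin n) :
    extendLast σ i.castSucc = (σ i).castSucc := by
  simp [extendLast, Equiv.permCongr_apply]

/-- Insert `Fin.last n` into the cycle of `j`, directly after `j`. -/
def insertAfter (σ : Equiv.Perm (Fin n)) (j : Fin n) : Equiv.Perm (Fin (n + 1)) :=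
  extendLast σ * Equiv.swap (Fin.last n) j.castSucc

@[simp] theorem insertAfter_last (σ : Equiv.Perm (Fin n)) (j : Fin n) :
    insertAfter σ j (Fin.last n) = (σ j).castSucc := by
  simp [insertAfter]

@[simp] theorem insertAfter_self (σ : Equiv.Perm (Fin n)) (j : Fin n) :
    insertAfter σ j j.castSucc = Fin.last n := by
  simp [insertAfter]

theorem insertAfter_of_ne (σ : Equiv.Perm (Fin n)) {i j : Fin n} (h : i ≠ j) :
    insertAfter σ j i.castSucc = (σ i).castSucc := by
  rw [insertAfter, Equiv.Perm.mul_apply, Equiv.swap_apply_of_ne_of_ne, extendLast_castSucc]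
  · exact i.castSucc_lt_last.ne
  · simpa using h

theorem extendLast_injective : Function.Injective (extendLast (n := n)) := by
  intro σ τ h
  ext i
  have := congrArg (fun π => π i.castSucc) h
  simpa [Fin.ext_iff] using this

/-- Every permutation of `Fin (n + 1)` arises once by inserting `Fin.last n` into a permutation
of `Fin n`, as a fixed point or after some element. -/
theorem sum_perm_succ {A : Type*} [AddCommMonoid A] (f : Equiv.Perm (Fin (n + 1)) → A) :
    ∑ π, f π = ∑ σ : Equiv.Perm (Fin n), (f (extendLast σ) + ∑ j, f (insertAfter σ j)) := by
  let e : Equiv.Perm (Fin n) × Option (Fin n) → Equiv.Perm (Fin (n + 1)) :=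
    fun p => p.2.elim (extendLast p.1) (insertAfter p.1)
  -- The preimage of `Fin.last n` tells which insertion was used; surjectivity follows by counting.
  have he : Function.Bijective e := by
    rw [Fintype.bijective_iff_injective_and_card]
    constructor
    · rintro ⟨σ, j⟩ ⟨τ, k⟩ h
      have hlast := congrArg (fun π => π⁻¹ (Fin.last n)) h
      have inv_ext : ∀ σ : Equiv.Perm (Fin n), (extendLast σ)⁻¹ (Fin.last n) = Fin.last n :=
        fun σ => by rw [Equiv.Perm.inv_eq_iff_eq, extendLast_last]
      have inv_ins : ∀ (σ : Equiv.Perm (Fin n)) (j : Fin n),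
          (insertAfter σ j)⁻¹ (Fin.last n) = j.castSucc :=
        fun σ j => by rw [Equiv.Perm.inv_eq_iff_eq, insertAfter_self]
      cases j with
      | none =>
        cases k with
        | none => simpa using extendLast_injective h
        | some k =>
          simp only [e, Option.elim, inv_ext, inv_ins] at hlast
          exact absurd hlast.symm k.castSucc_lt_last.ne
      | some j =>
        cases k with
        | none =>
          simp only [e, Option.elim, inv_ext, inv_ins] at hlast
          exact absurd hlast j.castSucc_lt_last.ne
        | some k =>
          simp only [e, Option.elim, inv_ins] at hlast
          obtain rfl := Fin.castSucc_injective n hlast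
          have := extendLast_injective (mul_right_cancel h)
          simpa using this
    · simp [Fintype.card_perm, Nat.factorial_succ, mul_comm]
  rw [← he.sum_comp f, Fintype.sum_prod_type]
  simp [e, Fintype.sum_option]

/-- Inclusion and the retraction sending the new point to `j` induce mutually inverse maps on
cycles. -/
theorem cyc_insertAfter (σ : Equiv.Perm (Fin n)) (j : Fin n) :
    cyc (insertAfter σ j) = cyc σ := by
  have step : ∀ i, (insertAfter σ j).SameCycle i.castSucc (σ i).castSucc := by
    intro i
    by_cases h : i = j
    · subst h
      -- The arc out of `j` now passes through `Fin.last n`, hence two steps.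
      refine ⟨2, ?_⟩
      rw [show (2 : ℤ) = 1 + 1 by norm_num, zpow_add, zpow_one, Equiv.Perm.mul_apply]
      simp
    · exact ⟨1, by simp [insertAfter_of_ne σ h]⟩
  let r : Fin (n + 1) → Fin n := Fin.lastCases j id
  have rl : r (Fin.last n) = j := by simp [r]
  have rc : ∀ i : Fin n, r i.castSucc = i := fun i => by simp [r]
  have rstep : ∀ a, σ.SameCycle (r a) (r (insertAfter σ j a)) := by
    intro a
    induction a using Fin.lastCases with
    | last => rw [insertAfter_last, rl, rc]; exact ⟨1, by simp⟩
    | cast i =>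
      by_cases h : i = j
      · subst h; rw [insertAfter_self, rl, rc]
      · rw [insertAfter_of_ne σ h, rc, rc]; exact ⟨1, by simp⟩
  refine Nat.card_congr
    { toFun := Quotient.map' r fun a b h => sameCycle_map r rstep h
      invFun := Quotient.map' Fin.castSucc fun a b h => sameCycle_map Fin.castSucc step h
      left_inv := ?_
      right_inv := ?_ }
  · rintro ⟨a⟩
    apply Quotient.sound
    change (insertAfter σ j).SameCycle (r a).castSucc a
    induction a using Fin.lastCases with
    | last => rw [rl]; exact ⟨1, by simp⟩
    | cast i => rw [rc]
  · rintro ⟨a⟩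
    apply Quotient.sound
    change σ.SameCycle (r a.castSucc) a
    rw [rc]

theorem cyc_extendLast (σ : Equiv.Perm (Fin n)) : cyc (extendLast σ) = cyc σ + 1 := by
  have step : ∀ i, (extendLast σ).SameCycle i.castSucc (σ i).castSucc :=
    fun i => ⟨1, by simp⟩
  let r : Fin (n + 1) → Option (Fin n) := Fin.lastCases none some
  have rl : r (Fin.last n) = none := by simp [r]
  have rc : ∀ i : Fin n, r i.castSucc = some i := fun i => by simp [r]
  let q : Fin (n + 1) → Option (Quotient (Equiv.Perm.SameCycle.setoid σ)) :=
    fun a => (r a).map (Quotient.mk _)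
  have ql : q (Fin.last n) = none := by simp [q, rl]
  have qc : ∀ i : Fin n, q i.castSucc = some (Quotient.mk _ i) := fun i => by simp [q, rc]
  have qstep : ∀ a, q a = q (extendLast σ a) := by
    intro a
    induction a using Fin.lastCases with
    | last => rw [extendLast_last]
    | cast i =>
      rw [extendLast_castSucc, qc, qc]
      exact congrArg some (Quotient.sound (⟨1, by simp⟩ : σ.SameCycle i (σ i)))
  have qinv : ∀ a b, (extendLast σ).SameCycle a b → q a = q b := by
    intro a b h
    -- For the identity permutation, lying in the same cycle means equality.
    have := sameCycle_map (τ := (1 : Equiv.Perm (Option (Quotient (Equiv.Perm.SameCycle.setoid σ))))) q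
      (fun a => by rw [← qstep a]) h
    simpa using this
  have e : Quotient (Equiv.Perm.SameCycle.setoid (extendLast σ)) ≃
      Option (Quotient (Equiv.Perm.SameCycle.setoid σ)) :=
    { toFun := Quotient.lift q qinv
      invFun := fun o => o.elim (Quotient.mk _ (Fin.last n))
        (Quotient.map' Fin.castSucc fun a b h => sameCycle_map Fin.castSucc step h)
      left_inv := by
        rintro ⟨a⟩
        change Option.elim (q a) _ _ = Quotient.mk _ a
        induction a using Fin.lastCases with
        | last => rw [ql]; rfl
        | cast i => rw [qc]; rfl
      right_inv := by
        rintro (_ | ⟨⟨a⟩⟩)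
        · exact ql
        · exact qc a }
  rw [cyc, cyc, Nat.card_congr e, Finite.card_option]

end Insertion

/-! ### J-fractions and three-term recurrences. -/

section Fractions

variable {R : Type*} [CommRing R]

theorem X_pow_dvd_jFraction_sub_jConvergent (N : ℕ) (d l : ℕ → R) :
    (X : R⟦X⟧) ^ N ∣ jFraction d l - jConvergent N d l := by
  rw [X_pow_dvd_iff]
  intro m hm
  rw [map_sub, coeff_jConvergent d l m N hm, sub_self]

/-- The limit of `jConvergent_succ_mul`: modulo each power of `X`, both fractions may be replaced by
convergents. -/
theorem jFraction_mul (d l : ℕ → R) :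
    (1 - C (l 0) * X - C (d 1) * X ^ 2 * jFraction (fun h => d (h + 1)) (fun h => l (h + 1)))
      * jFraction d l = 1 := by
  rw [← sub_eq_zero]
  ext n
  obtain ⟨p, hp⟩ := X_pow_dvd_jFraction_sub_jConvergent (n + 1)
    (fun h => d (h + 1)) (fun h => l (h + 1))
  obtain ⟨q, hq⟩ := X_pow_dvd_jFraction_sub_jConvergent (n + 1 + 1) d l
  have h1 := jConvergent_succ_mul (n + 1) d l
  rw [map_zero]
  refine X_pow_dvd_iff.mp (?_ : (X : R⟦X⟧) ^ (n + 1) ∣ _) n (Nat.lt_succ_self n)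
  refine ⟨(1 - C (l 0) * X - C (d 1) * X ^ 2 *
    jFraction (fun h => d (h + 1)) (fun h => l (h + 1))) * X * q
    - C (d 1) * X ^ 2 * jConvergent (n + 1 + 1) d l * p, ?_⟩
  linear_combination h1 + (1 - C (l 0) * X - C (d 1) * X ^ 2 *
    jFraction (fun h => d (h + 1)) (fun h => l (h + 1))) * hq
    - C (d 1) * X ^ 2 * jConvergent (n + 1 + 1) d l * hp

/-- The entry `d 0` does not enter the J-fraction. -/
theorem jFraction_congr {d d' l : ℕ → R} (h : ∀ k, d (k + 1) = d' (k + 1)) :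
    jFraction d l = jFraction d' l := by
  simp only [jFraction, jConvergent, h]

theorem map_jConvergent {S : Type*} [CommRing S] (φ : R →+* S) (N : ℕ) (d l : ℕ → R) :
    PowerSeries.map φ (jConvergent N d l) =
      jConvergent N (fun h => φ (d h)) (fun h => φ (l h)) := by
  induction N generalizing d l with
  | zero => simp [jConvergent]
  | succ N ih =>
    have h1 := congrArg (PowerSeries.map φ) (jConvergent_succ_mul N d l)
    have h2 := jConvergent_succ_mul N (fun h => φ (d h)) (fun h => φ (l h))
    simp only [map_mul, map_sub, map_one, map_pow, map_X, map_C, ih] at h1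
    exact (left_inv_eq_right_inv ((mul_comm _ _).trans h1) h2)

theorem map_jFraction {S : Type*} [CommRing S] (φ : R →+* S) (d l : ℕ → R) :
    PowerSeries.map φ (jFraction d l) =
      jFraction (fun h => φ (d h)) (fun h => φ (l h)) := by
  ext n
  rw [jFraction, jFraction, coeff_map, coeff_mk, coeff_mk, ← map_jConvergent, coeff_map]

/-- An array that obeys the three-term recurrence of weighted Motzkin paths has the coefficients
of the J-fraction in its zeroth column. -/
theorem mk_eq_jFraction_of_recurrence (B : ℕ → ℕ → R) (d l : ℕ → R)
    (h00 : B 0 0 = 1) (h0 : ∀ h, B 0 (h + 1) = 0)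
    (hz : ∀ n, B (n + 1) 0 = l 0 * B n 0 + B n 1)
    (hs : ∀ n h, B (n + 1) (h + 1) =
      d (h + 1) * B n h + l (h + 1) * B n (h + 1) + B n (h + 2)) :
    PowerSeries.mk (fun n => B n 0) = jFraction d l := by
  let J : ℕ → R⟦X⟧ := fun k => jFraction (fun h => d (h + k)) (fun h => l (h + k))
  have hJ : ∀ k, (1 - C (l k) * X - C (d (k + 1)) * X ^ 2 * J (k + 1)) * J k = 1 := by
    intro k
    have := jFraction_mul (fun h => d (h + k)) (fun h => l (h + k))
    simpa only [zero_add, add_assoc, add_comm 1 k] using this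
  -- `F h` is `d₁ ⋯ d_h X ^ h` times the product of the tails `J 0, …, J h`: the generating function
  -- of paths ending at height `h`.
  let F : ℕ → R⟦X⟧ := fun h => Nat.rec (J 0) (fun k f => C (d (k + 1)) * X * J (k + 1) * f) h
  have F0 : F 0 = J 0 := rfl
  have Fs : ∀ h, F (h + 1) = C (d (h + 1)) * X * J (h + 1) * F h := fun _ => rfl
  have e0 : F 0 = 1 + X * (C (l 0) * F 0 + F 1) := by
    have F1 : F 1 = C (d 1) * X * J 1 * J 0 := rfl
    rw [F1, F0]
    linear_combination hJ 0
  have es : ∀ h, F (h + 1) =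
      X * (C (d (h + 1)) * F h + C (l (h + 1)) * F (h + 1) + F (h + 2)) := by
    intro h
    rw [Fs (h + 1), Fs h]
    linear_combination (C (d (h + 1)) * X * F h) * hJ (h + 1)
  -- The factor `X` in `e0` and `es` makes these equations determine all coefficients by induction
  -- on `n`.
  have key : ∀ n h, coeff n (F h) = B n h := by
    intro n
    induction n with
    | zero =>
      intro h
      cases h with
      | zero => rw [e0, h00]; simp
      | succ h => rw [es, h0]; simp
    | succ n ih =>
      intro h
      cases h with
      | zero => rw [e0, hz]; simp [coeff_succ_X_mul, coeff_one, ih]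
      | succ h => rw [es, hs]; simp [coeff_succ_X_mul, ih]
  ext n
  rw [coeff_mk, ← key, F0]
  rfl

end Fractions

/-! ### Weights under insertion, with pending excedances as marks. -/

section Marked

variable {R : Type*} [CommRing R] {n : ℕ}

/-- Increasing excedances for a permutation with a set `M` of marked positions. The arc out of a
marked position stands for an excedance whose value is still to come: it lies above all values
seen so far. -/
def MarkedIncreasing (σ : Equiv.Perm (Fin n)) (M : Finset (Fin n)) : Prop :=
  ∀ i, i ∉ M → i < σ i →
    (∀ j ∈ M, i < j) ∧ ∀ j, j ∉ M → j < σ j → i < j → σ i < σ j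

/-- The weight of the position `i` in a permutation with marked positions `M`. -/
def posWeight (x v w : R) (σ : Equiv.Perm (Fin n)) (M : Finset (Fin n)) (i : Fin n) : R :=
  if i ∈ M then v
  else if σ i = i then x
  else if i < σ i then (if σ i ∈ M ∨ σ i < σ (σ i) then v * w else v)
  else 1

open Classical in
/-- The weight of a permutation with marked positions `M`; it vanishes unless the excedances are
increasing. -/
noncomputable def markedWeight (x v w t : R) (σ : Equiv.Perm (Fin n)) (M : Finset (Fin n)) : R :=
  if MarkedIncreasing σ M then (∏ i, posWeight x v w σ M i) * t ^ cyc σ else 0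

/-- The total weight of the permutations of `Fin n` with `h` marked positions. -/
noncomputable def markedSum (x v w t : R) (n h : ℕ) : R :=
  ∑ σ : Equiv.Perm (Fin n), ∑ M ∈ (Finset.univ : Finset (Fin n)).powersetCard h,
    markedWeight x v w t σ M

/-- The image of a set of positions under `Fin.castSucc`. -/
def liftMarks (M : Finset (Fin n)) : Finset (Fin (n + 1)) := M.map Fin.castSuccEmb

@[simp] theorem castSucc_mem_liftMarks {M : Finset (Fin n)} {i : Fin n} :
    i.castSucc ∈ liftMarks M ↔ i ∈ M := by
  simp [liftMarks]

@[simp] theorem last_notMem_liftMarks {M : Finset (Fin n)} : Fin.last n ∉ liftMarks M := by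
  simp [liftMarks, Fin.castSucc_ne_last]

theorem sum_powersetCard_succ_univ {A : Type*} [AddCommMonoid A] (h : ℕ)
    (f : Finset (Fin (n + 1)) → A) :
    ∑ M ∈ (Finset.univ : Finset (Fin (n + 1))).powersetCard (h + 1), f M =
      ∑ M ∈ (Finset.univ : Finset (Fin n)).powersetCard (h + 1), f (liftMarks M) +
      ∑ M ∈ (Finset.univ : Finset (Fin n)).powersetCard h,
        f (insert (Fin.last n) (liftMarks M)) := by
  have hu : (Finset.univ : Finset (Fin (n + 1))) =
      insert (Fin.last n) (liftMarks (Finset.univ : Finset (Fin n))) := by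
    ext i
    induction i using Fin.lastCases <;> simp
  rw [hu, Finset.powersetCard_succ_insert last_notMem_liftMarks, Finset.sum_union,
    Finset.sum_image]
  · simp [liftMarks, Finset.powersetCard_map, Finset.sum_map, Finset.mapEmbedding_apply]
  · intro S hS T hT hST
    have hn : ∀ U ∈ (liftMarks (Finset.univ : Finset (Fin n))).powersetCard h,
        Fin.last n ∉ U := fun U hU hl =>
      last_notMem_liftMarks ((Finset.mem_powersetCard.mp hU).1 hl)
    rw [← Finset.erase_insert (hn S hS), ← Finset.erase_insert (hn T hT)]
    exact congrArg (fun U => Finset.erase U (Fin.last n)) hST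
  · rw [Finset.disjoint_left]
    intro S hS hS'
    obtain ⟨T, -, rfl⟩ := Finset.mem_image.mp hS'
    exact last_notMem_liftMarks ((Finset.mem_powersetCard.mp hS).1 (Finset.mem_insert_self _ _))

/-- Splitting off the least element of a nonempty set. -/
theorem sum_powersetCard_insert_min {A : Type*} [AddCommMonoid A] (h : ℕ)
    (f : Finset (Fin n) → A) :
    ∑ M ∈ (Finset.univ : Finset (Fin n)).powersetCard h,
      ∑ j ∈ Finset.univ.filter (fun j => j ∉ M),
        (if ∀ k ∈ M, j < k then f (insert j M) else 0) =
    ∑ M ∈ (Finset.univ : Finset (Fin n)).powersetCard (h + 1), f M := by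
  simp_rw [← Finset.sum_filter]
  rw [Finset.sum_sigma']
  refine Finset.sum_bij (fun p _ => insert p.2 p.1) ?_ ?_ ?_ ?_
  · rintro ⟨M, j⟩ hp
    simp only [Finset.mem_sigma, Finset.mem_filter, Finset.mem_powersetCard] at hp
    simp [Finset.mem_powersetCard, Finset.card_insert_of_notMem hp.2.1.2, hp.1.2]
  · rintro ⟨M, j⟩ hp ⟨N, k⟩ hq hE
    simp only [Finset.mem_sigma, Finset.mem_filter, Finset.mem_powersetCard] at hp hq hE
    have hjk : j = k := by
      have h1 : j ∈ insert k N := hE ▸ Finset.mem_insert_self j M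
      have h2 : k ∈ insert j M := hE ▸ Finset.mem_insert_self k N
      rcases Finset.mem_insert.mp h1 with h1 | h1
      · exact h1
      · rcases Finset.mem_insert.mp h2 with h2 | h2
        · exact h2.symm
        · exact absurd (hp.2.2 k h2) (hq.2.2 j h1).asymm
    subst hjk
    have : M = N := by
      rw [← Finset.erase_insert hp.2.1.2, ← Finset.erase_insert hq.2.1.2, hE]
    subst this
    rfl
  · intro S hS
    have hc := (Finset.mem_powersetCard.mp hS).2
    have hne : S.Nonempty := Finset.card_pos.mp (by omega)
    refine ⟨⟨S.erase (S.min' hne), S.min' hne⟩, ?_, Finset.insert_erase (S.min'_mem hne)⟩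
    simp only [Finset.mem_sigma, Finset.mem_filter, Finset.mem_powersetCard, Finset.subset_univ,
      true_and, Finset.mem_univ, Finset.card_erase_of_mem (S.min'_mem hne), hc]
    exact ⟨by omega, Finset.notMem_erase _ _, fun k hk => Finset.min'_lt_of_mem_erase_min' S hne hk⟩
  · intros; rfl

variable (x v w t : R) (σ : Equiv.Perm (Fin n)) (M : Finset (Fin n)) (j : Fin n)

/-- Whether `Fin.last n` is marked is left open in `M'`: it exceeds every other position and is
never an excedance position, so it imposes no condition. -/
theorem markedIncreasing_extendLast {M' : Finset (Fin (n + 1))}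
    (hM' : ∀ i : Fin n, i.castSucc ∈ M' ↔ i ∈ M) :
    MarkedIncreasing (extendLast σ) M' ↔ MarkedIncreasing σ M := by
  simp only [MarkedIncreasing, Fin.forall_fin_succ', extendLast_castSucc, extendLast_last,
    hM', Fin.castSucc_lt_castSucc_iff, Fin.castSucc_lt_last, lt_irrefl, implies_true, and_true,
    false_implies]

theorem markedWeight_eq_mul {m : ℕ} {τ : Equiv.Perm (Fin m)} {N : Finset (Fin m)} (c : R)
    (hI : MarkedIncreasing τ N ↔ MarkedIncreasing σ M)
    (hw : (∏ i, posWeight x v w τ N i) * t ^ cyc τ =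
      c * ((∏ i, posWeight x v w σ M i) * t ^ cyc σ)) :
    markedWeight x v w t τ N = c * markedWeight x v w t σ M := by
  by_cases h : MarkedIncreasing σ M
  · rw [markedWeight, markedWeight, if_pos h, if_pos (hI.mpr h), hw]
  · rw [markedWeight, markedWeight, if_neg h, if_neg (mt hI.mp h), mul_zero]

theorem markedWeight_extendLast :
    markedWeight x v w t (extendLast σ) (liftMarks M) = x * t * markedWeight x v w t σ M := by
  refine markedWeight_eq_mul x v w t σ M (x * t)
    (markedIncreasing_extendLast σ M fun i => castSucc_mem_liftMarks) ?_
  simp [cyc_extendLast, posWeight, Fin.prod_univ_castSucc]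
  ring

theorem markedWeight_extendLast_insert :
    markedWeight x v w t (extendLast σ) (insert (Fin.last n) (liftMarks M)) =
      v * t * markedWeight x v w t σ M := by
  refine markedWeight_eq_mul x v w t σ M (v * t)
    (markedIncreasing_extendLast σ M fun i => by simp [Fin.castSucc_ne_last]) ?_
  simp [cyc_extendLast, posWeight, Fin.prod_univ_castSucc, Fin.castSucc_ne_last]
  ring

/-- The only old arc that changes leaves a marked position, where the actual value is ignored. -/
theorem markedIncreasing_insertAfter_of_mem (hj : j ∈ M) {M' : Finset (Fin (n + 1))}
    (hM' : ∀ i : Fin n, i.castSucc ∈ M' ↔ i ∈ M) :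
    MarkedIncreasing (insertAfter σ j) M' ↔ MarkedIncreasing σ M := by
  have hne : ∀ i, i ∉ M → insertAfter σ j i.castSucc = (σ i).castSucc :=
    fun i hi => insertAfter_of_ne σ (fun h => hi (h ▸ hj))
  have hlast : ¬ Fin.last n < (σ j).castSucc := (Fin.castSucc_lt_last _).asymm
  simp +contextual only [MarkedIncreasing, Fin.forall_fin_succ', hne, insertAfter_last,
    hM', Fin.castSucc_lt_castSucc_iff, Fin.castSucc_lt_last, implies_true, and_true,
    hlast, false_implies, not_false_eq_true]

theorem posWeight_insertAfter_of_mem (hj : j ∈ M) {M' : Finset (Fin (n + 1))}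
    (hM' : ∀ i : Fin n, i.castSucc ∈ M' ↔ i ∈ M) (i : Fin n) :
    posWeight x v w (insertAfter σ j) M' i.castSucc = posWeight x v w σ M i := by
  by_cases hi : i ∈ M
  · simp [posWeight, hM', hi]
  · have hij : i ≠ j := fun h => hi (h ▸ hj)
    by_cases hs : σ i = j
    · simp [posWeight, hM', hi, insertAfter_of_ne σ hij, hs, hj]
    · simp [posWeight, hM', hi, insertAfter_of_ne σ hij, insertAfter_of_ne σ hs]

theorem markedWeight_insertAfter_of_mem (hj : j ∈ M) :
    markedWeight x v w t (insertAfter σ j) (liftMarks M) = markedWeight x v w t σ M := by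
  have hM' : ∀ i : Fin n, i.castSucc ∈ liftMarks M ↔ i ∈ M := fun i => castSucc_mem_liftMarks
  have hl : posWeight x v w (insertAfter σ j) (liftMarks M) (Fin.last n) = 1 := by
    simp [posWeight, Fin.castSucc_ne_last, (Fin.castSucc_lt_last _).asymm]
  rw [← one_mul (markedWeight x v w t σ M)]
  refine markedWeight_eq_mul x v w t σ M 1
    (markedIncreasing_insertAfter_of_mem σ M j hj hM') ?_
  simp only [Fin.prod_univ_castSucc, posWeight_insertAfter_of_mem x v w σ M j hj hM',
    cyc_insertAfter, hl, one_mul, mul_one]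

theorem markedWeight_insertAfter_insert_of_mem (hj : j ∈ M) :
    markedWeight x v w t (insertAfter σ j) (insert (Fin.last n) (liftMarks M)) =
      v * markedWeight x v w t σ M := by
  have hM' : ∀ i : Fin n, i.castSucc ∈ insert (Fin.last n) (liftMarks M) ↔ i ∈ M :=
    fun i => by simp [Fin.castSucc_ne_last]
  have hl : posWeight x v w (insertAfter σ j) (insert (Fin.last n) (liftMarks M))
      (Fin.last n) = v := by
    simp [posWeight]
  refine markedWeight_eq_mul x v w t σ M v
    (markedIncreasing_insertAfter_of_mem σ M j hj hM') ?_
  simp only [Fin.prod_univ_castSucc, posWeight_insertAfter_of_mem x v w σ M j hj hM',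
    cyc_insertAfter, hl]
  ring

/-- Before the insertion `j` was a marked position, and `Fin.last n` is its value at last. Being the
largest value so far, it needs all other excedances seen so far to come before `j`, and all
remaining marks after it. -/
theorem markedIncreasing_insertAfter_of_notMem (hj : j ∉ M) {M' : Finset (Fin (n + 1))}
    (hM' : ∀ i : Fin n, i.castSucc ∈ M' ↔ i ∈ M) :
    MarkedIncreasing (insertAfter σ j) M' ↔
      (∀ k ∈ M, j < k) ∧ MarkedIncreasing σ (insert j M) := by
  have hlast : ¬ Fin.last n < (σ j).castSucc := (Fin.castSucc_lt_last _).asymm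
  have hne : ∀ i, i ≠ j → insertAfter σ j i.castSucc = (σ i).castSucc :=
    fun i hi => insertAfter_of_ne σ hi
  constructor
  · intro H
    have Hj := H j.castSucc (by rwa [hM']) (by simp [Fin.castSucc_lt_last])
    refine ⟨fun k hk => by simpa using Hj.1 k.castSucc (by rwa [hM']), ?_⟩
    intro i hi hlt
    rw [Finset.mem_insert, not_or] at hi
    have Hi := H i.castSucc (by rw [hM']; exact hi.2) (by simpa [hne i hi.1] using hlt)
    refine ⟨?_, ?_⟩
    · intro k hk
      rcases Finset.mem_insert.mp hk with rfl | hk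
      -- If `i` came after `j`, its value would have to exceed `Fin.last n`.
      · by_contra hik
        have hki : k < i := lt_of_le_of_ne (not_lt.mp hik) (Ne.symm hi.1)
        have := Hj.2 i.castSucc (by rw [hM']; exact hi.2) (by simpa [hne i hi.1] using hlt)
          (by simpa using hki)
        rw [insertAfter_self] at this
        exact absurd this (Fin.le_last _).not_gt
      · simpa using Hi.1 k.castSucc (by rwa [hM'])
    · intro k hk hkl hik
      rw [Finset.mem_insert, not_or] at hk
      simpa [hne i hi.1, hne k hk.1] using
        Hi.2 k.castSucc (by rw [hM']; exact hk.2) (by simpa [hne k hk.1] using hkl)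
          (by simpa using hik)
  · rintro ⟨hmin, H⟩ i hi hlt
    induction i using Fin.lastCases with
    | last => rw [insertAfter_last] at hlt; exact absurd hlt hlast
    | cast i =>
      rw [hM'] at hi
      by_cases hij : i = j
      · subst hij
        refine ⟨fun k hk => ?_, fun k hk hkl hik => ?_⟩
        · induction k using Fin.lastCases with
          | last => exact Fin.castSucc_lt_last _
          | cast k => simpa using hmin k ((hM' k).mp hk)
        · induction k using Fin.lastCases with
          | last => rw [insertAfter_last] at hkl; exact absurd hkl hlast
          | cast k =>
            rw [hM'] at hk
            have hki : k ≠ i := by rintro rfl; exact lt_irrefl _ hik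
            rw [hne k hki, Fin.castSucc_lt_castSucc_iff] at hkl
            have := (H k (by simp [hki, hk]) hkl).1 i (Finset.mem_insert_self _ _)
            exact absurd this (by simpa using hik.le)
      · rw [hne i hij, Fin.castSucc_lt_castSucc_iff] at hlt
        have Hi := H i (by simp [hij, hi]) hlt
        refine ⟨fun k hk => ?_, fun k hk hkl hik => ?_⟩
        · induction k using Fin.lastCases with
          | last => exact Fin.castSucc_lt_last _
          | cast k => simpa using Hi.1 k (Finset.mem_insert_of_mem ((hM' k).mp hk))
        · induction k using Fin.lastCases with
          | last => rw [insertAfter_last] at hkl; exact absurd hkl hlast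
          | cast k =>
            rw [hM'] at hk
            by_cases hkj : k = j
            · subst hkj; rw [hne i hij, insertAfter_self]; exact Fin.castSucc_lt_last _
            · rw [hne k hkj, Fin.castSucc_lt_castSucc_iff] at hkl
              rw [hne i hij, hne k hkj, Fin.castSucc_lt_castSucc_iff]
              exact Hi.2 k (by simp [hkj, hk]) hkl (by simpa using hik)

theorem posWeight_insertAfter_of_notMem {M' : Finset (Fin (n + 1))}
    (hM' : ∀ i : Fin n, i.castSucc ∈ M' ↔ i ∈ M) {i : Fin n} (hij : i ≠ j) :
    posWeight x v w (insertAfter σ j) M' i.castSucc = posWeight x v w σ (insert j M) i := by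
  by_cases hs : σ i = j
  -- An excedance with value `j` is double both before (`j` is marked) and after (`j` goes to
  -- `Fin.last n`).
  · simp [posWeight, hM', hij, insertAfter_of_ne σ hij, hs, Fin.castSucc_lt_last]
  · simp [posWeight, hM', hij, insertAfter_of_ne σ hij, insertAfter_of_ne σ hs, hs]

/-- Only `j` and the new point change the product; the `v` in `c * v` is the weight that `j` already
had as a mark. -/
theorem prod_posWeight_insertAfter_of_notMem {M' : Finset (Fin (n + 1))}
    (hM' : ∀ i : Fin n, i.castSucc ∈ M' ↔ i ∈ M) (c : R)
    (hc : posWeight x v w (insertAfter σ j) M' j.castSucc *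
      posWeight x v w (insertAfter σ j) M' (Fin.last n) = c * v) :
    ∏ i, posWeight x v w (insertAfter σ j) M' i = c * ∏ i, posWeight x v w σ (insert j M) i := by
  have hjw : posWeight x v w σ (insert j M) j = v := by simp [posWeight]
  rw [Fin.prod_univ_castSucc, ← Finset.mul_prod_erase Finset.univ _ (Finset.mem_univ j),
    ← Finset.mul_prod_erase Finset.univ (posWeight x v w σ (insert j M)) (Finset.mem_univ j), hjw,
    Finset.prod_congr rfl fun i hi => posWeight_insertAfter_of_notMem x v w σ M j hM'
      (Finset.ne_of_mem_erase hi)]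
  linear_combination (∏ i ∈ Finset.univ.erase j, posWeight x v w σ (insert j M) i) * hc

theorem markedWeight_insertAfter_of_notMem_eq_mul (hj : j ∉ M) {M' : Finset (Fin (n + 1))}
    (hM' : ∀ i : Fin n, i.castSucc ∈ M' ↔ i ∈ M) (c : R)
    (hc : posWeight x v w (insertAfter σ j) M' j.castSucc *
      posWeight x v w (insertAfter σ j) M' (Fin.last n) = c * v) :
    markedWeight x v w t (insertAfter σ j) M' =
      c * if ∀ k ∈ M, j < k then markedWeight x v w t σ (insert j M) else 0 := by
  have hI := markedIncreasing_insertAfter_of_notMem σ M j hj hM'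
  by_cases hmin : ∀ k ∈ M, j < k
  · rw [if_pos hmin]
    refine markedWeight_eq_mul x v w t σ (insert j M) c (hI.trans (and_iff_right hmin)) ?_
    rw [prod_posWeight_insertAfter_of_notMem x v w σ M j hM' c hc, cyc_insertAfter, mul_assoc]
  · rw [if_neg hmin, mul_zero, markedWeight, if_neg fun h => hmin (hI.mp h).1]

theorem markedWeight_insertAfter_of_notMem (hj : j ∉ M) :
    markedWeight x v w t (insertAfter σ j) (liftMarks M) =
      if ∀ k ∈ M, j < k then markedWeight x v w t σ (insert j M) else 0 := by
  rw [markedWeight_insertAfter_of_notMem_eq_mul x v w t σ M j hj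
    (fun i => castSucc_mem_liftMarks) 1, one_mul]
  simp [posWeight, hj, Fin.castSucc_lt_last, Fin.castSucc_ne_last,
    (Fin.castSucc_lt_last _).asymm, (Fin.castSucc_ne_last _).symm]

theorem markedWeight_insertAfter_insert_of_notMem (hj : j ∉ M) :
    markedWeight x v w t (insertAfter σ j) (insert (Fin.last n) (liftMarks M)) =
      v * w * if ∀ k ∈ M, j < k then markedWeight x v w t σ (insert j M) else 0 := by
  refine markedWeight_insertAfter_of_notMem_eq_mul x v w t σ M j hj
    (fun i => by simp [Fin.castSucc_ne_last]) (v * w) ?_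
  simp [posWeight, hj, Fin.castSucc_lt_last, Fin.castSucc_ne_last,
    (Fin.castSucc_ne_last _).symm]

end Marked

/-! ### The recurrence for marked sums, and all permutations with increasing excedances. -/

section Recurrence

variable {R : Type*} [CommRing R] (x v w t : R)

theorem sum_markedWeight_insertAfter {n : ℕ} (σ : Equiv.Perm (Fin n)) (h : ℕ) :
    ∑ M ∈ (Finset.univ : Finset (Fin n)).powersetCard h,
      ∑ j, markedWeight x v w t (insertAfter σ j) (liftMarks M) =
    h * ∑ M ∈ (Finset.univ : Finset (Fin n)).powersetCard h, markedWeight x v w t σ M +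
    ∑ M ∈ (Finset.univ : Finset (Fin n)).powersetCard (h + 1), markedWeight x v w t σ M := by
  rw [← sum_powersetCard_insert_min, Finset.mul_sum, ← Finset.sum_add_distrib]
  refine Finset.sum_congr rfl fun M hM => ?_
  -- Marked `j` give the `h` equal terms; an unmarked `j` counts as the least element of a set of `h
  -- + 1` former marks.
  rw [← Finset.sum_filter_add_sum_filter_not Finset.univ (fun j => j ∈ M)]
  congr 1
  · rw [Finset.sum_congr rfl fun j hj => markedWeight_insertAfter_of_mem x v w t σ M j
      (Finset.mem_filter.mp hj).2]
    simp [(Finset.mem_powersetCard.mp hM).2]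
  · exact Finset.sum_congr rfl fun j hj => markedWeight_insertAfter_of_notMem x v w t σ M j
      (Finset.mem_filter.mp hj).2

theorem sum_markedWeight_insertAfter_insert {n : ℕ} (σ : Equiv.Perm (Fin n)) (h : ℕ) :
    ∑ M ∈ (Finset.univ : Finset (Fin n)).powersetCard h,
      ∑ j, markedWeight x v w t (insertAfter σ j) (insert (Fin.last n) (liftMarks M)) =
    v * h * ∑ M ∈ (Finset.univ : Finset (Fin n)).powersetCard h, markedWeight x v w t σ M +
    v * w *
      ∑ M ∈ (Finset.univ : Finset (Fin n)).powersetCard (h + 1), markedWeight x v w t σ M := by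
  rw [← sum_powersetCard_insert_min, Finset.mul_sum, Finset.mul_sum, ← Finset.sum_add_distrib]
  refine Finset.sum_congr rfl fun M hM => ?_
  rw [← Finset.sum_filter_add_sum_filter_not Finset.univ (fun j => j ∈ M)]
  congr 1
  · rw [Finset.sum_congr rfl fun j hj => markedWeight_insertAfter_insert_of_mem x v w t σ M j
      (Finset.mem_filter.mp hj).2]
    simp [(Finset.mem_powersetCard.mp hM).2]
    ring
  · rw [Finset.mul_sum]
    exact Finset.sum_congr rfl fun j hj => markedWeight_insertAfter_insert_of_notMem x v w t σ M j
      (Finset.mem_filter.mp hj).2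

theorem markedSum_succ_zero (n : ℕ) :
    markedSum x v w t (n + 1) 0 = x * t * markedSum x v w t n 0 + markedSum x v w t n 1 := by
  have key : ∀ σ : Equiv.Perm (Fin n), ∑ j, markedWeight x v w t (insertAfter σ j) ∅ =
      ∑ M ∈ (Finset.univ : Finset (Fin n)).powersetCard 1, markedWeight x v w t σ M := by
    intro σ
    simpa [liftMarks] using sum_markedWeight_insertAfter x v w t σ 0
  have ext : ∀ σ : Equiv.Perm (Fin n), markedWeight x v w t (extendLast σ) ∅ =
      x * t * markedWeight x v w t σ ∅ := by
    intro σ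
    simpa [liftMarks] using markedWeight_extendLast x v w t σ ∅
  simp only [markedSum, Finset.powersetCard_zero, Finset.sum_singleton, sum_perm_succ, key, ext,
    Finset.sum_add_distrib, Finset.mul_sum]

theorem markedSum_succ_succ (n h : ℕ) :
    markedSum x v w t (n + 1) (h + 1) = v * (h + t) * markedSum x v w t n h +
      (x * t + v * w + (h + 1)) * markedSum x v w t n (h + 1) + markedSum x v w t n (h + 2) := by
  have ins := fun σ : Equiv.Perm (Fin n) => sum_markedWeight_insertAfter x v w t σ (h + 1)
  have ins' := fun σ : Equiv.Perm (Fin n) => sum_markedWeight_insertAfter_insert x v w t σ h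
  have key : ∀ σ : Equiv.Perm (Fin n),
      (∑ M ∈ (Finset.univ : Finset (Fin (n + 1))).powersetCard (h + 1),
        markedWeight x v w t (extendLast σ) M) +
      ∑ j, ∑ M ∈ (Finset.univ : Finset (Fin (n + 1))).powersetCard (h + 1),
        markedWeight x v w t (insertAfter σ j) M =
      v * (h + t) * ∑ M ∈ (Finset.univ : Finset (Fin n)).powersetCard h,
        markedWeight x v w t σ M +
      (x * t + v * w + (h + 1)) * ∑ M ∈ (Finset.univ : Finset (Fin n)).powersetCard (h + 1),
        markedWeight x v w t σ M +
      ∑ M ∈ (Finset.univ : Finset (Fin n)).powersetCard (h + 2), markedWeight x v w t σ M := by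
    intro σ
    rw [Finset.sum_comm, sum_powersetCard_succ_univ, sum_powersetCard_succ_univ, ins, ins']
    simp only [markedWeight_extendLast, markedWeight_extendLast_insert, ← Finset.mul_sum]
    push_cast
    ring
  simp only [markedSum, sum_perm_succ, key]
  simp only [Finset.sum_add_distrib, ← Finset.mul_sum]

theorem prod_posWeight_empty {n : ℕ} (π : Equiv.Perm (Fin n)) :
    ∏ i, posWeight x v w π ∅ i = x ^ fp π * v ^ exc π * w ^ dexc π := by
  rw [fp, exc, dexc, Finset.card_filter, Finset.card_filter, Finset.card_filter,
    ← Finset.prod_pow_eq_pow_sum, ← Finset.prod_pow_eq_pow_sum, ← Finset.prod_pow_eq_pow_sum,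
    ← Finset.prod_mul_distrib, ← Finset.prod_mul_distrib]
  refine Finset.prod_congr rfl fun i _ => ?_
  by_cases h1 : π i = i
  · simp [posWeight, h1]
  · by_cases h2 : i < π i
    · by_cases h3 : π i < π (π i) <;> simp [posWeight, h1, h2, h3]
    · simp [posWeight, h1, h2]

theorem markedSum_zero_right (n : ℕ) :
    markedSum x v w t n 0 =
      ∑ π ∈ IE n, x ^ fp π * v ^ exc π * w ^ dexc π * t ^ cyc π := by
  classical
  have hI : ∀ π : Equiv.Perm (Fin n), MarkedIncreasing π ∅ ↔ IncreasingExcedances π := by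
    intro π
    simp only [MarkedIncreasing, IncreasingExcedances, Finset.notMem_empty, not_false_eq_true,
      true_implies, false_implies, implies_true, true_and]
    exact ⟨fun H i j hij hi hj => H i hi j hj hij, fun H i hi j hj hij => H i j hij hi hj⟩
  simp only [markedSum, Finset.powersetCard_zero, Finset.sum_singleton, markedWeight, hI,
    prod_posWeight_empty, IE, Finset.sum_filter]

theorem mk_sum_IE_eq_jFraction :
    PowerSeries.mk (fun n => ∑ π ∈ IE n, x ^ fp π * v ^ exc π * w ^ dexc π * t ^ cyc π) =
      jFraction (fun h => v * ((h : R) - 1 + t))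
        (fun h => if h = 0 then x * t else x * t + v * w + (h : R)) := by
  have h00 : markedSum x v w t 0 0 = 1 := by
    have hc : ∀ π : Equiv.Perm (Fin 0), cyc π = 0 := fun π => by
      have : IsEmpty (Quotient (Equiv.Perm.SameCycle.setoid π)) :=
        ⟨fun q => q.inductionOn fun a => a.elim0⟩
      rw [cyc, Nat.card_of_isEmpty]
    have hI : ∀ π : Equiv.Perm (Fin 0), MarkedIncreasing π ∅ := fun π i => i.elim0
    simp only [markedSum, markedWeight, Finset.powersetCard_zero, Finset.sum_singleton, hI, hc]
    simp
  simp only [← markedSum_zero_right]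
  refine mk_eq_jFraction_of_recurrence (markedSum x v w t) _ _ h00 ?_ ?_ ?_
  · intro h
    refine Finset.sum_eq_zero fun σ _ => ?_
    rw [Finset.powersetCard_eq_empty.mpr (by simp), Finset.sum_empty]
  · intro n
    simpa using markedSum_succ_zero x v w t n
  · intro n h
    rw [markedSum_succ_succ]
    simp

end Recurrence

/-! ### Cyclic permutations, by extracting the coefficient of `t`. -/

section Cyclic

variable {R : Type*} [CommRing R] (x v w : R)

theorem mk_sum_CIE_eq_kFraction :
    PowerSeries.mk (fun n => ∑ π ∈ CIE n, x ^ fp π * v ^ exc π * w ^ dexc π) =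
      kFraction (fun h => if h = 1 then v else ((h : R) - 1) * v)
        (fun h => if h = 0 then x else v * w + (h : R)) := by
  classical
  -- The cycle variable must be formal for its coefficient to be taken, so the work is done over
  -- `R[T]`.
  let T : Polynomial R := Polynomial.X
  let d : ℕ → Polynomial R := fun h => Polynomial.C v * ((h : Polynomial R) - 1 + T)
  let l : ℕ → Polynomial R := fun h => if h = 0 then Polynomial.C x * T
    else Polynomial.C x * T + Polynomial.C v * Polynomial.C w + (h : Polynomial R)
  let J' := jFraction (fun h => d (h + 1)) (fun h => l (h + 1))
  let A : (Polynomial R)⟦X⟧ := C (Polynomial.C x) * X + C (Polynomial.C v) * X ^ 2 * J'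
  have hJ : jFraction d l = 1 + C T * (A * jFraction d l) := by
    have := jFraction_mul d l
    have h0 : C (l 0) = C T * C (Polynomial.C x) := by simp [l, mul_comm]
    have h1 : C (d 1) = C T * C (Polynomial.C v) := by simp [d, mul_comm]
    rw [h0, h1] at this
    simp only [A, J']
    linear_combination this
  let φ : Polynomial R →+* R := Polynomial.constantCoeff
  have φT : φ T = 0 := by simp [φ, T]
  have φC : ∀ r, φ (Polynomial.C r) = r := fun r => by simp [φ]
  -- At `T = 0` only the empty permutation survives.
  have hφJ : PowerSeries.map φ (jFraction d l) = 1 := by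
    rw [hJ]
    simp [φT]
  have hφA : PowerSeries.map φ A = kFraction (fun h => if h = 1 then v else ((h : R) - 1) * v)
      (fun h => if h = 0 then x else v * w + (h : R)) := by
    simp only [A, J', kFraction, map_add, map_mul, map_pow, map_X, map_C, map_jFraction, φC]
    have hl : (fun h => φ (l (h + 1))) =
        fun h => if h + 1 = 0 then x else v * w + ((h + 1 : ℕ) : R) := by
      ext h
      simp [l, φT, φC]
    rw [hl, jFraction_congr (d' := fun h => if h + 1 = 1 then v else (((h + 1 : ℕ) : R) - 1) * v)]
    · simp
    · intro h
      simp [d, φT, φC, mul_comm]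
  rw [← hφA, ← mul_one (PowerSeries.map φ A), ← hφJ, ← map_mul]
  ext n
  -- The coefficient of `T` in `1 + T A J` is the constant coefficient of `A J`, and on the
  -- permutation side it selects `cyc π = 1`.
  have hn := congrArg (fun f => (coeff n f).coeff 1) hJ
  simp only [map_add, coeff_C_mul, Polynomial.coeff_add] at hn
  rw [Polynomial.coeff_X_mul (n := 0), coeff_one] at hn
  rw [coeff_mk, coeff_map]
  change _ = (coeff n (A * jFraction d l)).coeff 0
  have h1 : (if n = 0 then (1 : Polynomial R) else 0).coeff 1 = 0 := by
    split_ifs <;> simp [Polynomial.coeff_one]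
  rw [h1, zero_add] at hn
  rw [← hn, ← mk_sum_IE_eq_jFraction (Polynomial.C x) (Polynomial.C v) (Polynomial.C w) T,
    coeff_mk, Polynomial.finsetSum_coeff, CIE, IE, Finset.sum_filter, Finset.sum_filter]
  refine Finset.sum_congr rfl fun π _ => ?_
  by_cases hI : IncreasingExcedances π
  · have hc : (Polynomial.C x ^ fp π * Polynomial.C v ^ exc π * Polynomial.C w ^ dexc π *
        T ^ cyc π).coeff 1 = if cyc π = 1 then x ^ fp π * v ^ exc π * w ^ dexc π else 0 := by
      simp only [T, ← Polynomial.C_pow, ← Polynomial.C_mul, Polynomial.coeff_C_mul,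
        Polynomial.coeff_X_pow, mul_ite, mul_one, mul_zero, eq_comm (a := 1)]
    simp [hI, hc, IsCyclic]
  · simp [hI]

end Cyclic

end PermStat

open PermStat in
/-- Formal variables are covered by `R = ℤ[x, v, w, t]`; the variable `z` is `PowerSeries.X`. -/
theorem mainTheorem6 {R : Type*} [CommRing R] (x v w t : R) :
    PowerSeries.mk (fun n => ∑ π ∈ IE n, x ^ fp π * v ^ exc π * w ^ dexc π * t ^ cyc π) =
      jFraction (fun h => v * ((h : R) - 1 + t))
        (fun h => if h = 0 then x * t else x * t + v * w + (h : R)) ∧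
    PowerSeries.mk (fun n => ∑ π ∈ CIE n, x ^ fp π * v ^ exc π * w ^ dexc π) =
      kFraction (fun h => if h = 1 then v else ((h : R) - 1) * v)
        (fun h => if h = 0 then x else v * w + (h : R)) ∧
    PowerSeries.mk (fun n => ∑ π ∈ CIE n, x ^ fp π * v ^ exc π * w ^ dexc π * t ^ cyc π) =
      PowerSeries.C t * kFraction (fun h => if h = 1 then v else ((h : R) - 1) * v)
        (fun h => if h = 0 then x else v * w + (h : R)) ∧
    PowerSeries.mk (fun n => if 1 ≤ n then ((CIE n).card : ℤ) else 0) =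
      kFraction (fun h => if h = 1 then 1 else (h : ℤ) - 1) (fun h => (h : ℤ) + 1) := by
  have hcyc : ∀ n, ∀ π ∈ CIE n, cyc π = 1 := fun n π hπ => by
    classical
    exact (Finset.mem_filter.mp hπ).2.1
  refine ⟨mk_sum_IE_eq_jFraction x v w t, mk_sum_CIE_eq_kFraction x v w, ?_, ?_⟩
  · rw [← mk_sum_CIE_eq_kFraction]
    ext n
    rw [PowerSeries.coeff_C_mul, PowerSeries.coeff_mk, PowerSeries.coeff_mk, Finset.mul_sum]
    refine Finset.sum_congr rfl fun π hπ => ?_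
    rw [hcyc n π hπ, pow_one, mul_comm]
  · have h := mk_sum_CIE_eq_kFraction (1 : ℤ) 1 1
    have hl : (fun h : ℕ => if h = 0 then (1 : ℤ) else 1 * 1 + (h : ℤ)) =
        fun h : ℕ => (h : ℤ) + 1 := by
      ext h
      split_ifs with h0
      · simp [h0]
      · ring
    simp only [mul_one, one_pow, Finset.sum_const, nsmul_eq_mul] at h hl
    rw [hl] at h
    rw [← h]
    ext n
    rw [PowerSeries.coeff_mk]
    split_ifs with hn
    · rw [PowerSeries.coeff_mk]
    -- At `n = 0` the elevated fraction has no constant term, matching the default value 0.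
    · obtain rfl : n = 0 := by omega
      simp [h, kFraction]
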